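/- Let $H\in(\tfrac12,1)$ and let $B^H=(B^H(t))_{t\ge 0}$ be a fractional Brownian motion with Hurst parameter $H$ on a probability space, i.e. a Gaussian process with almost surely continuous paths such that, for all $s,t\ge0$, $\mathbb E[B^H(t)]=B^H(0)$ almost surely and $\mathrm{Cov}(B^H(t),B^H(s))=\frac12\left(t^{2H}+s^{2H}-|t-s|^{2H}\right)$. Let $S(t)=e^{B^H(t)}$ be the associated geometric fractional Brownian motion and let $T>0$. Then for every $t\in[0,T]$ it holds almost surely that $$\frac{T-t}{T}S(t)+\frac1T\int_0^t S(s)\,ds=S(0)+\int_0^t\frac{T-s}{T}S(s)\,dB^H(s),$$ where the stochastic integral exists pathwise as a limit of Riemann sums: for almost every $\omega$, for every sequence of partitions $0=t_0\le t_1\le\dots\le t_n=t$ whose maximum step size goes to zero and all choices of points $\xi_i\in[t_i,t_{i+1}]$ (in particular $\xi_i=t_i$), the sums $\sum_{i<n}\frac{T-\xi_i}{T}S(\xi_i)\left(B^H(t_{i+1})-B^H(t_i)\right)$ converge to it. In particular, for $t=T$, almost surely $$\frac1T\int_0^T S(s)\,ds=S(0)+\int_0^T\frac{T-s}{T}S(s)\,dB^H(s).$$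 -/

import Mathlib

open MeasureTheory ProbabilityTheory Filter Topology
open scoped NNReal

/-- `B` is a fractional Brownian motion with Hurst parameter `H` under `P`: a Gaussian process
indexed by `[0, ∞)` with `E[B t] = B 0` (so the starting point is almost surely a constant, not
necessarily zero), with the fractional covariance, and with almost surely continuous paths. -/
structure IsFractionalBrownianMotion {Ω : Type*} [MeasurableSpace Ω] (H : ℝ)
    (B : ℝ≥0 → Ω → ℝ) (P : Measure Ω) : Prop where
  isGaussianProcess : IsGaussianProcess B P
  mean_eq : ∀ t : ℝ≥0, ∀ᵐ ω ∂P, ∫ ω', B t ω' ∂P = B 0 ω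
  covariance_eq : ∀ t s : ℝ≥0, covariance (B t) (B s) P =
    1 / 2 * ((t : ℝ) ^ (2 * H) + (s : ℝ) ^ (2 * H) - |(t : ℝ) - (s : ℝ)| ^ (2 * H))
  continuous_paths : ∀ᵐ ω ∂P, Continuous fun t : ℝ≥0 => B t ω

/-- The geometric process `S(t) = exp (B t)` of `B`. -/
noncomputable def geometricProcess {Ω : Type*} (B : ℝ≥0 → Ω → ℝ) (t : ℝ≥0) (ω : Ω) : ℝ :=
  Real.exp (B t ω)

/-- A tagged partition `a = p 0 ≤ p 1 ≤ ⋯ ≤ p n = b` of the interval `[a, b]`, with a tag in each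
of the `n` subintervals. -/
structure TaggedIntervalPartition (a b : ℝ≥0) where
  /-- the number of subintervals -/
  n : ℕ
  /-- the division points -/
  point : Fin (n + 1) → ℝ≥0
  /-- the evaluation points -/
  tag : Fin n → ℝ≥0
  point_zero : point 0 = a
  point_last : point (Fin.last n) = b
  monotone_point : Monotone point
  tag_mem : ∀ i : Fin n, tag i ∈ Set.Icc (point i.castSucc) (point i.succ)

namespace TaggedIntervalPartition

/-- The maximum step size of a partition. -/
noncomputable def mesh {a b : ℝ≥0} (π : TaggedIntervalPartition a b) : ℝ :=
  ⨆ i : Fin π.n, ((π.point i.succ : ℝ) - (π.point i.castSucc : ℝ))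

/-- The Riemann sum of `f` with respect to the increments of `g`. -/
noncomputable def riemannSum {a b : ℝ≥0} (f g : ℝ≥0 → ℝ) (π : TaggedIntervalPartition a b) : ℝ :=
  ∑ i : Fin π.n, f (π.tag i) * (g (π.point i.succ) - g (π.point i.castSucc))

end TaggedIntervalPartition

/-- `∫_a^b f dg` exists as a limit of Riemann sums and equals `I`: along every sequence of tagged
partitions of `[a, b]` whose maximum step size goes to zero, the Riemann sums converge to `I`. -/
def HasRiemannStieltjesIntegral (f g : ℝ≥0 → ℝ) (a b : ℝ≥0) (I : ℝ) : Prop :=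
  ∀ π : ℕ → TaggedIntervalPartition a b,
    Tendsto (fun k => (π k).mesh) atTop (𝓝 0) →
      Tendsto (fun k => (π k).riemannSum f g) atTop (𝓝 I)

/-!
The identity is a pathwise chain rule, and no integration theory is needed for it. Put
`G t = (T - t) / T * S t + 1 / T * ∫₀ᵗ S`. If a path `b` of `B` is Hölder continuous of order `α`,
then by Taylor's formula the increment of `G` over `[u, v]` equals `(T - ξ) / T * S ξ * (b v - b u)`
up to `O((v - u) ^ (2 α))`, for every tag `ξ ∈ [u, v]`
(`exists_abs_timeAverage_sub_le`): the two terms of first order in `v - u`, from the factor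
`T - t` and from the time integral, cancel. When `α > 1 / 2` these errors add up to
`O(mesh ^ (2 α - 1))` over a partition, so the Riemann sums converge to the telescoping sum
`G t - G 0` (`hasRiemannStieltjesIntegral_of_abs_sub_le`). This gives existence of the integral and
its value at once.

Hölder continuity of some order `α ∈ (1 / 2, H)` is the Kolmogorov-Chentsov theorem. The increment
`B s - B t` is centred Gaussian with variance `|s - t| ^ (2 H)`, so its `p`-th absolute moment is a
multiple of `|s - t| ^ (H p)`. For large `p` the weighted `p`-th powers of all dyadic increments
then have a finite expected sum (`IsAEKolmogorovProcess.ae_exists_dyadic_le`), and since the paths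
are continuous a chaining argument passes from dyadic increments to all increments
(`Continuous.exists_holder_of_dyadic`).
-/

/-! ### Hölder continuity from dyadic increments -/

/-- The largest dyadic number of level `n` that is at most `s`. -/
noncomputable def dyadicFloor (n : ℕ) (s : ℝ≥0) : ℝ≥0 := (⌊2 ^ n * s⌋₊ : ℝ≥0) / 2 ^ n

lemma dyadicFloor_le (n : ℕ) (s : ℝ≥0) : dyadicFloor n s ≤ s := by
  rw [dyadicFloor, div_le_iff₀ (by positivity), mul_comm]
  exact Nat.floor_le (by positivity)

lemma lt_dyadicFloor_add (n : ℕ) (s : ℝ≥0) : s < dyadicFloor n s + (1 / 2) ^ n := by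
  have h := Nat.lt_floor_add_one (2 ^ n * s)
  rw [dyadicFloor, one_div_pow, ← add_div, lt_div_iff₀ (by positivity), mul_comm]
  exact h

lemma tendsto_dyadicFloor (s : ℝ≥0) :
    Tendsto (fun n => dyadicFloor n s) atTop (𝓝 s) := by
  have h0 : Tendsto (fun n : ℕ => s - (1 / 2 : ℝ≥0) ^ n) atTop (𝓝 s) := by
    have h1 : Tendsto (fun n : ℕ => (1 / 2 : ℝ≥0) ^ n) atTop (𝓝 0) :=
      NNReal.tendsto_pow_atTop_nhds_zero_of_lt_one
        (by rw [div_lt_one (by simp)]; exact one_lt_two)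
    simpa using (tendsto_const_nhds (x := s)).sub h1
  exact tendsto_of_tendsto_of_tendsto_of_le_of_le h0 tendsto_const_nhds
    (fun n => tsub_le_iff_right.2 (lt_dyadicFloor_add n s).le) (fun n => dyadicFloor_le n s)

lemma floor_two_pow_mul_lt {N : ℕ} {s : ℝ≥0} (hs : s < N) (n : ℕ) :
    ⌊2 ^ n * s⌋₊ < N * 2 ^ n := by
  rw [Nat.floor_lt (by positivity), mul_comm]
  push_cast
  gcongr

/-- The chaining argument: a continuous function whose increments over neighbouring dyadic numbers
of level `n` are `O(2 ^ (-n α))` is Hölder continuous of order `α`. -/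
theorem Continuous.exists_holder_of_dyadic {E : Type*} [PseudoMetricSpace E] {f : ℝ≥0 → E}
    (hf : Continuous f) {α C : ℝ} (hα : 0 < α) (hC : 0 ≤ C) {N : ℕ}
    (h : ∀ n k : ℕ, k < N * 2 ^ n →
      dist (f (k / 2 ^ n)) (f ((k + 1) / 2 ^ n)) ≤ C * ((2 : ℝ) ^ (-α)) ^ n) :
    ∃ K : ℝ, 0 ≤ K ∧ ∀ s t : ℝ≥0, s < N → t < N → dist s t ≤ 1 →
      dist (f s) (f t) ≤ K * dist s t ^ α := by
  set ρ : ℝ := 2 ^ (-α) with hρ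
  have hρ0 : 0 < ρ := by positivity
  have hρ1 : ρ < 1 := Real.rpow_lt_one_of_one_lt_of_neg one_lt_two (by linarith)
  have step : ∀ n j k : ℕ, j < N * 2 ^ n → j ≤ k → k ≤ j + 1 →
      dist (f (j / 2 ^ n)) (f (k / 2 ^ n)) ≤ C * ρ ^ n := by
    intro n j k hj hjk hkj
    obtain rfl | rfl : k = j ∨ k = j + 1 := by omega
    · simp only [dist_self]; positivity
    · simpa using h n j hj
  have approx : ∀ (s : ℝ≥0) (n : ℕ), s < N →
      dist (f (dyadicFloor n s)) (f s) ≤ C * ρ ^ n / (1 - ρ) := by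
    intro s n hs
    refine dist_le_of_le_geometric_of_tendsto (f := fun n => f (dyadicFloor n s)) ρ C hρ1
      (fun n => ?_) ((hf.tendsto s).comp (tendsto_dyadicFloor s)) n
    have hfl : dyadicFloor n s = ((2 * ⌊2 ^ n * s⌋₊ : ℕ) : ℝ≥0) / 2 ^ (n + 1) := by
      rw [dyadicFloor, pow_succ]; push_cast
      rw [mul_comm (2 ^ n : ℝ≥0) 2, mul_div_mul_left _ _ two_ne_zero]
    have h1 : 2 * ⌊2 ^ n * s⌋₊ ≤ ⌊2 ^ (n + 1) * s⌋₊ := by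
      apply Nat.le_floor
      push_cast
      rw [pow_succ', mul_assoc]
      gcongr
      exact Nat.floor_le (by positivity)
    have h2 : ⌊2 ^ (n + 1) * s⌋₊ ≤ 2 * ⌊2 ^ n * s⌋₊ + 1 := by
      rw [← Nat.lt_add_one_iff, Nat.floor_lt (by positivity)]
      have := Nat.lt_floor_add_one (2 ^ n * s)
      calc (2 : ℝ≥0) ^ (n + 1) * s = 2 * (2 ^ n * s) := by ring
        _ < 2 * (⌊2 ^ n * s⌋₊ + 1) := by gcongr
        _ = _ := by push_cast; ring
    have := step (n + 1) _ _ (h1.trans_lt (floor_two_pow_mul_lt hs _)) h1 h2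
    rw [hfl]
    refine this.trans ?_
    gcongr C * ?_
    exact pow_le_pow_of_le_one hρ0.le hρ1.le n.le_succ
  refine ⟨(2 * (C / (1 - ρ)) + C) * 2 ^ α, ?_, ?_⟩
  · have := sub_pos.2 hρ1
    positivity
  intro s t
  wlog hst : s ≤ t generalizing s t
  · intro hs ht hd
    rw [dist_comm s, dist_comm (f s)] at *
    exact this t s (le_of_not_ge hst) ht hs hd
  intro hs ht hd
  have hdist : dist s t = t - s := by
    rw [dist_comm, NNReal.dist_eq, abs_of_nonneg (sub_nonneg.2 (by exact_mod_cast hst))]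
  rcases hst.eq_or_lt with rfl | hlt
  · simp [hα.ne']
  have hpos : 0 < dist s t := by rw [hdist]; exact sub_pos.2 (by exact_mod_cast hlt)
  -- at the level `m` with `2 ^ (-m - 1) < dist s t ≤ 2 ^ (-m)`, the dyadic floors of `s` and `t`
  -- are equal or neighbours
  obtain ⟨m, hm1, hm2⟩ := exists_nat_pow_near_of_lt_one hpos hd (y := (1 / 2 : ℝ))
    (by norm_num) (by norm_num)
  have hmid : dist (f (dyadicFloor m s)) (f (dyadicFloor m t)) ≤ C * ρ ^ m := by
    refine step m _ _ (floor_two_pow_mul_lt hs m) (Nat.floor_mono (by gcongr)) ?_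
    rw [← Nat.floor_add_one (by positivity)]
    apply Nat.floor_mono
    have : t ≤ s + (1 / 2) ^ m := by
      rw [← NNReal.coe_le_coe]; push_cast; linarith
    calc (2 : ℝ≥0) ^ m * t ≤ 2 ^ m * (s + (1 / 2) ^ m) := by gcongr
      _ = 2 ^ m * s + 1 := by rw [mul_add, ← mul_pow]; simp
  have hρm : ρ ^ m ≤ 2 ^ α * dist s t ^ α := by
    rw [← Real.mul_rpow (by norm_num) hpos.le, hρ, Real.rpow_neg (by norm_num),
      ← Real.inv_rpow (by norm_num), ← Real.rpow_natCast, ← Real.rpow_mul (by norm_num), mul_comm,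
      Real.rpow_mul (by norm_num), Real.rpow_natCast]
    refine Real.rpow_le_rpow (by positivity) ?_ hα.le
    rw [pow_succ, one_div] at hm1
    linarith
  have h1 : 0 < 1 - ρ := sub_pos.2 hρ1
  calc dist (f s) (f t)
      ≤ dist (f s) (f (dyadicFloor m s)) + dist (f (dyadicFloor m s)) (f (dyadicFloor m t))
        + dist (f (dyadicFloor m t)) (f t) := dist_triangle4 _ _ _ _
    _ ≤ C * ρ ^ m / (1 - ρ) + C * ρ ^ m + C * ρ ^ m / (1 - ρ) := by
        rw [dist_comm (f s)]
        exact add_le_add (add_le_add (approx s m hs) hmid) (approx t m ht)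
    _ = (2 * (C / (1 - ρ)) + C) * ρ ^ m := by ring
    _ ≤ (2 * (C / (1 - ρ)) + C) * (2 ^ α * dist s t ^ α) := by gcongr
    _ = _ := by ring

/-! ### Riemann sums over tagged partitions -/

namespace TaggedIntervalPartition

variable {a b : ℝ≥0} (π : TaggedIntervalPartition a b)

lemma step_nonneg (i : Fin π.n) :
    0 ≤ (π.point i.succ : ℝ) - π.point i.castSucc :=
  sub_nonneg.2 (NNReal.coe_le_coe.2 (π.monotone_point i.castSucc_le_succ))

lemma step_le_mesh (i : Fin π.n) :
    (π.point i.succ : ℝ) - π.point i.castSucc ≤ π.mesh :=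
  le_ciSup (f := fun i : Fin π.n => (π.point i.succ : ℝ) - π.point i.castSucc)
    (Set.finite_range _).bddAbove i

lemma sum_sub (G : ℝ≥0 → ℝ) :
    ∑ i : Fin π.n, (G (π.point i.succ) - G (π.point i.castSucc)) = G b - G a := by
  have key : ∀ (n : ℕ) (u : Fin (n + 1) → ℝ),
      ∑ i : Fin n, (u i.succ - u i.castSucc) = u (Fin.last n) - u 0 := by
    intro n u
    have h1 := Fin.sum_univ_succ u
    rw [Fin.sum_univ_castSucc] at h1
    rw [Finset.sum_sub_distrib]
    linarith
  rw [key π.n fun i => G (π.point i), π.point_last, π.point_zero]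

end TaggedIntervalPartition

/-- If the increments of `G` agree with `f dg` up to an error of order `γ > 1` in the length of
the interval, then the Riemann sums of `f dg` converge to the total increment of `G`: the errors
add up to `O(mesh ^ (γ - 1))`. -/
theorem hasRiemannStieltjesIntegral_of_abs_sub_le {f g G : ℝ≥0 → ℝ} {a b : ℝ≥0} {K γ : ℝ}
    (hγ : 1 < γ) (hK : 0 ≤ K)
    (h : ∀ u ξ v : ℝ≥0, u ≤ ξ → ξ ≤ v → v ≤ b → (v : ℝ) - u ≤ 1 →
      |G v - G u - f ξ * (g v - g u)| ≤ K * ((v : ℝ) - u) ^ γ) :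
    HasRiemannStieltjesIntegral f g a b (G b - G a) := by
  intro π hπ
  rw [← tendsto_sub_nhds_zero_iff]
  have hlim : Tendsto (fun k => K * (π k).mesh ^ (γ - 1) * ((b : ℝ) - a)) atTop (𝓝 0) := by
    have := (hπ.rpow_const (p := γ - 1) (Or.inr (by linarith))).const_mul K |>.mul_const
      ((b : ℝ) - a)
    rwa [Real.zero_rpow (by linarith), mul_zero, zero_mul] at this
  refine squeeze_zero_norm' ?_ hlim
  filter_upwards [hπ.eventually_le_const zero_lt_one] with k hk
  generalize π k = p at hk
  have hlocal : ∀ i : Fin p.n,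
      |f (p.tag i) * (g (p.point i.succ) - g (p.point i.castSucc))
        - (G (p.point i.succ) - G (p.point i.castSucc))|
      ≤ K * p.mesh ^ (γ - 1) * ((p.point i.succ : ℝ) - p.point i.castSucc) := by
    intro i
    have hle := p.step_le_mesh i
    have h0 := p.step_nonneg i
    have hb : p.point i.succ ≤ b :=
      (p.monotone_point (Fin.le_last _)).trans_eq p.point_last
    rw [abs_sub_comm]
    refine (h _ _ _ (p.tag_mem i).1 (p.tag_mem i).2 hb (hle.trans hk)).trans ?_
    have hsplit : ∀ x : ℝ, 0 ≤ x → x ^ γ = x ^ (γ - 1) * x := by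
      intro x hx
      rw [← Real.rpow_add_one' hx (by linarith), sub_add_cancel]
    rw [hsplit _ h0, mul_assoc]
    gcongr
  rw [Real.norm_eq_abs, TaggedIntervalPartition.riemannSum, ← p.sum_sub G, ← Finset.sum_sub_distrib]
  refine (Finset.abs_sum_le_sum_abs _ _).trans ((Finset.sum_le_sum fun i _ => hlocal i).trans ?_)
  rw [← Finset.mul_sum, p.sum_sub fun t => (t : ℝ)]

/-! ### The chain rule for a Hölder continuous path -/

lemma Real.mul_sub_le_exp_sub_exp (x y : ℝ) : exp y * (x - y) ≤ exp x - exp y := by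
  have h := add_one_le_exp (x - y)
  have h2 : exp x = exp y * exp (x - y) := by rw [← exp_add]; ring_nf
  rw [h2]
  nlinarith [exp_pos y]

lemma Real.abs_exp_sub_exp_le {x y R : ℝ} (hx : x ≤ R) (hy : y ≤ R) :
    |exp x - exp y| ≤ exp R * |x - y| := by
  wlog hxy : y ≤ x generalizing x y
  · rw [abs_sub_comm, abs_sub_comm x]
    exact this hy hx (le_of_not_ge hxy)
  rw [abs_of_nonneg (sub_nonneg.2 (exp_le_exp.2 hxy)), abs_of_nonneg (sub_nonneg.2 hxy)]
  have h1 := mul_sub_le_exp_sub_exp y x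
  have h2 := mul_le_mul_of_nonneg_right (exp_le_exp.2 hx) (sub_nonneg.2 hxy)
  linarith

/-- First order Taylor estimate for the exponential with the derivative taken at a third point
`z`, all points being within `δ` of each other. -/
lemma Real.abs_exp_sub_exp_sub_mul_le {x y z R δ : ℝ} (hx : x ≤ R) (hy : y ≤ R) (hz : z ≤ R)
    (hxy : |x - y| ≤ δ) (hxz : |x - z| ≤ δ) (hyz : |y - z| ≤ δ) :
    |exp x - exp y - exp z * (x - y)| ≤ exp R * δ ^ 2 := by
  have hδ : 0 ≤ δ := (abs_nonneg _).trans hxy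
  -- `exp x - exp y` lies between `exp y * (x - y)` and `exp x * (x - y)`, so it suffices to compare
  -- the slopes `exp x` and `exp y` with `exp z`
  have key : ∀ w, w ≤ R → |w - z| ≤ δ →
      |(exp w - exp z) * (x - y)| ≤ exp R * δ ^ 2 := by
    intro w hw hwz
    rw [abs_mul, sq, ← mul_assoc]
    have := abs_exp_sub_exp_le hw hz
    gcongr
    exact this.trans (by gcongr)
  have h1 := abs_le.1 (key x hx hxz)
  have h2 := abs_le.1 (key y hy hyz)
  have h3 := mul_sub_le_exp_sub_exp x y
  have h4 := mul_sub_le_exp_sub_exp y x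
  rw [abs_le]
  constructor <;> linarith

/-- For a path `b`, the function `(T - t) / T * exp (b t) + 1 / T * ∫₀ᵗ exp (b s) ds` of `t`: its
value at `0` is `exp (b 0)`, and at `T` it is the time average of `exp ∘ b` over `[0, T]`. -/
noncomputable def timeAverage (T : ℝ≥0) (b : ℝ≥0 → ℝ) (t : ℝ≥0) : ℝ :=
  ((T : ℝ) - t) / T * Real.exp (b t) + 1 / T * ∫ s in (0 : ℝ)..t, Real.exp (b s.toNNReal)

/-- The pathwise chain rule up to second order: on an interval of length `v - u`, the increment of
`timeAverage T b` is `(T - ξ) / T * exp (b ξ)` times that of `b`, up to `O((v - u) ^ (2 α))`. -/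
theorem exists_abs_timeAverage_sub_le {b : ℝ≥0 → ℝ} (hb : Continuous b) {T : ℝ≥0} (hT : 0 < T)
    {α C : ℝ} (hα : 0 < α) (hα1 : α ≤ 1) (hC : 0 ≤ C)
    (hhold : ∀ s t : ℝ≥0, s ≤ T → t ≤ T → dist s t ≤ 1 → dist (b s) (b t) ≤ C * dist s t ^ α) :
    ∃ K : ℝ, 0 ≤ K ∧ ∀ u ξ v : ℝ≥0, u ≤ ξ → ξ ≤ v → v ≤ T → (v : ℝ) - u ≤ 1 →
      |timeAverage T b v - timeAverage T b u
          - ((T : ℝ) - ξ) / T * Real.exp (b ξ) * (b v - b u)| ≤ K * ((v : ℝ) - u) ^ (2 * α) := by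
  obtain ⟨R, hR⟩ := (isCompact_Icc (a := 0) (b := T)).bddAbove_image hb.continuousOn
  replace hR : ∀ s ≤ T, b s ≤ R := fun s hs => hR ⟨s, ⟨zero_le, hs⟩, rfl⟩
  have hT' : (0 : ℝ) < T := hT
  refine ⟨Real.exp R * C ^ 2 + 3 * (Real.exp R * C) / T, by positivity, ?_⟩
  intro u ξ v huξ hξv hvT hvu
  have huξ' : (u : ℝ) ≤ ξ := huξ
  have hξv' : (ξ : ℝ) ≤ v := hξv
  have hvT' : (v : ℝ) ≤ T := hvT
  have hξ0 : (0 : ℝ) ≤ ξ := ξ.2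
  set Δ : ℝ := (v : ℝ) - u with hΔ
  have hΔ0 : 0 ≤ Δ := by linarith
  set δ : ℝ := C * Δ ^ α with hδ
  have hδ0 : 0 ≤ δ := by positivity
  have hosc : ∀ x y : ℝ≥0, u ≤ x → x ≤ v → u ≤ y → y ≤ v → |b x - b y| ≤ δ := by
    intro x y hux hxv huy hyv
    have hd : dist x y ≤ Δ := by
      have h1 : (u : ℝ) ≤ x := hux
      have h2 : (x : ℝ) ≤ v := hxv
      have h3 : (u : ℝ) ≤ y := huy
      have h4 : (y : ℝ) ≤ v := hyv
      rw [NNReal.dist_eq, abs_le]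
      constructor <;> linarith
    refine (hhold x y (hxv.trans hvT) (hyv.trans hvT) (hd.trans hvu)).trans ?_
    rw [hδ]
    gcongr
  have hexp : ∀ x : ℝ≥0, u ≤ x → x ≤ v →
      |Real.exp (b x) - Real.exp (b ξ)| ≤ Real.exp R * δ := by
    intro x hux hxv
    refine (Real.abs_exp_sub_exp_le (hR x (hxv.trans hvT)) (hR ξ (hξv.trans hvT))).trans ?_
    gcongr
    exact hosc x ξ hux hxv huξ hξv
  have hv := hexp v (huξ.trans hξv) le_rfl
  have hu := hexp u le_rfl (huξ.trans hξv)
  have hmain := Real.abs_exp_sub_exp_sub_mul_le (hR v hvT) (hR u ((huξ.trans hξv).trans hvT))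
    (hR ξ (hξv.trans hvT)) (hosc v u (huξ.trans hξv) le_rfl le_rfl (huξ.trans hξv))
    (hosc v ξ (huξ.trans hξv) le_rfl huξ hξv) (hosc u ξ le_rfl (huξ.trans hξv) huξ hξv)
  have hcont : Continuous fun s : ℝ => Real.exp (b s.toNNReal) := by fun_prop
  have hint : |∫ s in (u : ℝ)..v, (Real.exp (b s.toNNReal) - Real.exp (b ξ))|
      ≤ Real.exp R * δ * Δ := by
    have := intervalIntegral.norm_integral_le_of_norm_le_const (a := (u : ℝ)) (b := v)
      (f := fun s : ℝ => Real.exp (b s.toNNReal) - Real.exp (b ξ)) (C := Real.exp R * δ) ?_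
    · rwa [Real.norm_eq_abs, ← hΔ, abs_of_nonneg hΔ0] at this
    · intro s hs
      rw [Set.uIoc_of_le (huξ'.trans hξv')] at hs
      exact hexp _ (NNReal.le_toNNReal_of_coe_le hs.1.le) (Real.toNNReal_le_iff_le_coe.2 hs.2)
  have hsplit : ∫ s in (0 : ℝ)..v, Real.exp (b s.toNNReal)
      = (∫ s in (0 : ℝ)..u, Real.exp (b s.toNNReal))
        + ((∫ s in (u : ℝ)..v, (Real.exp (b s.toNNReal) - Real.exp (b ξ)))
          + Δ * Real.exp (b ξ)) := by
    rw [intervalIntegral.integral_sub (hcont.intervalIntegrable _ _) (by simp),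
      intervalIntegral.integral_const, smul_eq_mul, sub_add_cancel,
      intervalIntegral.integral_add_adjacent_intervals (hcont.intervalIntegrable _ _)
        (hcont.intervalIntegrable _ _)]
  -- subtracting `S ξ` in the last two parts is free, because `S ξ * (ξ - v) - S ξ * (ξ - u)` and
  -- the integral of `S ξ` over `[u, v]` cancel
  have hdecomp : timeAverage T b v - timeAverage T b u
        - ((T : ℝ) - ξ) / T * Real.exp (b ξ) * (b v - b u)
      = ((T : ℝ) - ξ) / T * (Real.exp (b v) - Real.exp (b u) - Real.exp (b ξ) * (b v - b u))
        + (((ξ : ℝ) - v) * (Real.exp (b v) - Real.exp (b ξ))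
          - ((ξ : ℝ) - u) * (Real.exp (b u) - Real.exp (b ξ))
          + ∫ s in (u : ℝ)..v, (Real.exp (b s.toNNReal) - Real.exp (b ξ))) / T := by
    rw [timeAverage, timeAverage, hsplit, hΔ]
    field_simp
    ring
  have hbound1 : |((T : ℝ) - ξ) / T
      * (Real.exp (b v) - Real.exp (b u) - Real.exp (b ξ) * (b v - b u))|
      ≤ Real.exp R * δ ^ 2 := by
    rw [abs_mul]
    have h1 : |((T : ℝ) - ξ) / T| ≤ 1 := by
      rw [abs_of_nonneg (div_nonneg (by linarith) hT'.le), div_le_one hT']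
      linarith
    simpa using mul_le_mul h1 hmain (abs_nonneg _) zero_le_one
  have hbound2 : |((ξ : ℝ) - v) * (Real.exp (b v) - Real.exp (b ξ))
          - ((ξ : ℝ) - u) * (Real.exp (b u) - Real.exp (b ξ))
          + ∫ s in (u : ℝ)..v, (Real.exp (b s.toNNReal) - Real.exp (b ξ))|
      ≤ 3 * (Real.exp R * δ * Δ) := by
    have h1 : |((ξ : ℝ) - v) * (Real.exp (b v) - Real.exp (b ξ))| ≤ Real.exp R * δ * Δ := by
      rw [abs_mul, mul_comm]
      gcongr
      rw [abs_le]; constructor <;> linarith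
    have h2 : |((ξ : ℝ) - u) * (Real.exp (b u) - Real.exp (b ξ))| ≤ Real.exp R * δ * Δ := by
      rw [abs_mul, mul_comm]
      gcongr
      rw [abs_le]; constructor <;> linarith
    rw [abs_le] at *
    constructor <;> linarith
  have hsq : δ ^ 2 = C ^ 2 * Δ ^ (2 * α) := by
    rw [hδ, mul_pow, mul_comm 2 α, Real.rpow_mul hΔ0, Real.rpow_two]
  -- `Δ * Δ ^ α ≤ Δ ^ (2 * α)` uses `Δ ≤ 1` and `α ≤ 1`
  have hlin : δ * Δ ≤ C * Δ ^ (2 * α) := by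
    rw [hδ, mul_assoc, two_mul, Real.rpow_add_of_nonneg hΔ0 hα.le hα.le]
    gcongr
    exact Real.self_le_rpow_of_le_one hΔ0 hvu hα1
  rw [hdecomp]
  refine (abs_add_le _ _).trans ?_
  rw [abs_div, abs_of_pos hT']
  calc _ ≤ Real.exp R * δ ^ 2 + 3 * (Real.exp R * δ * Δ) / T := by gcongr
    _ ≤ Real.exp R * (C ^ 2 * Δ ^ (2 * α)) + 3 * (Real.exp R * (C * Δ ^ (2 * α))) / T := by
        rw [hsq, mul_assoc (Real.exp R) δ]
        gcongr
    _ = _ := by ring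

/-! ### Hölder continuity of fractional Brownian motion -/

/-- The probabilistic half of the Kolmogorov-Chentsov theorem: the weighted sum of the `p`-th
moments of all dyadic increments converges, so almost surely the dyadic increments of level `n` are
`O(2 ^ (-n α))`. -/
theorem ProbabilityTheory.IsAEKolmogorovProcess.ae_exists_dyadic_le {Ω E : Type*}
    [MeasurableSpace Ω] {P : Measure Ω} [PseudoMetricSpace E] {X : ℝ≥0 → Ω → E} {p q α : ℝ}
    {M : ℝ≥0} (hX : IsAEKolmogorovProcess X P p q M) (hpq : 1 + α * p < q) (N : ℕ) :
    ∀ᵐ ω ∂P, ∃ C : ℝ, 0 ≤ C ∧ ∀ n k : ℕ, k < N * 2 ^ n →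
      dist (X (k / 2 ^ n) ω) (X ((k + 1) / 2 ^ n) ω) ≤ C * ((2 : ℝ) ^ (-α)) ^ n := by
  have hp := hX.p_pos
  -- `W n` has expectation at most `N * M * r ^ n` with `r = 2 ^ (1 + α * p - q) < 1`: there are
  -- `N * 2 ^ n` increments, each of `p`-th moment at most `M * 2 ^ (-n q)`
  let W : ℕ → Ω → ENNReal := fun n ω => ∑ k ∈ Finset.range (N * 2 ^ n),
    ((2 : ENNReal) ^ (α * p)) ^ n * edist (X (k / 2 ^ n) ω) (X ((k + 1) / 2 ^ n) ω) ^ p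
  have hmeas : ∀ n, AEMeasurable (W n) P := fun n =>
    Finset.aemeasurable_fun_sum _ fun k _ => (hX.aemeasurable_edist.pow_const p).const_mul _
  have hW : ∀ n, ∫⁻ ω, W n ω ∂P ≤ N * M * ((2 : ENNReal) ^ (1 + α * p - q)) ^ n := by
    intro n
    rw [lintegral_finsetSum' _ fun k _ => (hX.aemeasurable_edist.pow_const p).const_mul _]
    have hterm : ∀ k ∈ Finset.range (N * 2 ^ n),
        ∫⁻ ω, ((2 : ENNReal) ^ (α * p)) ^ n
          * edist (X (k / 2 ^ n) ω) (X ((k + 1) / 2 ^ n) ω) ^ p ∂P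
        ≤ ((2 : ENNReal) ^ (α * p)) ^ n * (M * ((2 : ENNReal) ^ (-q)) ^ n) := by
      intro k _
      rw [lintegral_const_mul'' _ (hX.aemeasurable_edist.pow_const p)]
      gcongr
      refine (hX.kolmogorovCondition _ _).trans_eq ?_
      congr 1
      have hd : edist ((k : ℝ≥0) / 2 ^ n) ((k + 1) / 2 ^ n) = ((2 : ENNReal) ^ n)⁻¹ := by
        rw [edist_comm, edist_nndist, NNReal.nndist_eq, add_div, add_tsub_cancel_left,
          tsub_eq_zero_of_le le_self_add]
        simp
      rw [hd, ENNReal.rpow_neg, ← ENNReal.rpow_natCast, ← ENNReal.rpow_natCast, ENNReal.inv_rpow,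
        ENNReal.inv_rpow, ← ENNReal.rpow_mul, ← ENNReal.rpow_mul, mul_comm]
    refine (Finset.sum_le_sum hterm).trans_eq ?_
    rw [Finset.sum_const, Finset.card_range, nsmul_eq_mul, sub_eq_add_neg,
      ENNReal.rpow_add _ _ two_ne_zero ENNReal.ofNat_ne_top,
      ENNReal.rpow_add _ _ two_ne_zero ENNReal.ofNat_ne_top, ENNReal.rpow_one]
    push_cast
    ring
  have hfin : ∫⁻ ω, ∑' n, W n ω ∂P ≠ ⊤ := by
    rw [lintegral_tsum hmeas]
    refine ne_top_of_le_ne_top ?_ (ENNReal.tsum_le_tsum hW)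
    rw [ENNReal.tsum_mul_left, ENNReal.tsum_geometric]
    have hr : (2 : ENNReal) ^ (1 + α * p - q) < 1 :=
      ENNReal.rpow_lt_one_of_one_lt_of_neg ENNReal.one_lt_two (by linarith)
    exact ENNReal.mul_ne_top (ENNReal.mul_ne_top (ENNReal.natCast_ne_top N) ENNReal.coe_ne_top)
      (ENNReal.inv_ne_top.2 (tsub_pos_of_lt hr).ne')
  filter_upwards [ae_lt_top' (AEMeasurable.tsum hmeas) hfin] with ω hω
  set A : ENNReal := ∑' n, W n ω with hA
  refine ⟨(A ^ p⁻¹).toReal, ENNReal.toReal_nonneg, fun n k hk => ?_⟩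
  have h1 : ((2 : ENNReal) ^ (α * p)) ^ n
      * edist (X (k / 2 ^ n) ω) (X ((k + 1) / 2 ^ n) ω) ^ p ≤ A :=
    (Finset.single_le_sum (f := fun k : ℕ => ((2 : ENNReal) ^ (α * p)) ^ n
      * edist (X (k / 2 ^ n) ω) (X ((k + 1) / 2 ^ n) ω) ^ p) (fun _ _ => zero_le)
      (Finset.mem_range.2 hk)).trans (ENNReal.le_tsum n)
  have h2 : edist (X (k / 2 ^ n) ω) (X ((k + 1) / 2 ^ n) ω)
      ≤ A ^ p⁻¹ * ((2 : ENNReal) ^ (-α)) ^ n := by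
    have hpow : ((2 : ENNReal) ^ (α * p)) ^ n = (((2 : ENNReal) ^ α) ^ n) ^ p := by
      rw [ENNReal.rpow_mul, ← ENNReal.rpow_natCast, ← ENNReal.rpow_natCast, ← ENNReal.rpow_mul _ p,
        ← ENNReal.rpow_mul _ _ p, mul_comm p]
    rw [hpow, ← ENNReal.mul_rpow_of_nonneg _ _ hp.le, ← ENNReal.le_rpow_inv_iff hp, mul_comm,
      ← ENNReal.le_div_iff_mul_le (by simp) (by simp)] at h1
    rwa [ENNReal.rpow_neg, ← ENNReal.inv_pow, ← div_eq_mul_inv]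
  rw [edist_dist] at h2
  have h4 := ENNReal.toReal_mono (by finiteness) h2
  rwa [ENNReal.toReal_ofReal dist_nonneg, ENNReal.toReal_mul, ENNReal.toReal_pow,
    ← ENNReal.toReal_rpow 2, ENNReal.toReal_ofNat] at h4

/-- Gaussian scaling: the `p`-th absolute moment of a centred Gaussian variable of variance
`σ ^ 2` is `σ ^ p` times that of a standard one. -/
lemma ProbabilityTheory.HasGaussianLaw.lintegral_enorm_rpow {Ω : Type*} [MeasurableSpace Ω]
    {P : Measure Ω} {X : Ω → ℝ} (hX : HasGaussianLaw X P) {σ p : ℝ} (hσ : 0 ≤ σ) (hp : 0 ≤ p)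
    (hmean : P[X] = 0) (hvar : Var[X; P] = σ ^ 2) :
    ∫⁻ ω, ‖X ω‖ₑ ^ p ∂P = ENNReal.ofReal σ ^ p * ∫⁻ z, ‖z‖ₑ ^ p ∂(gaussianReal 0 1) := by
  have hlaw : P.map X = (gaussianReal 0 1).map (σ * ·) := by
    rw [hX.map_eq_gaussianReal, hmean, hvar, gaussianReal_map_const_mul, mul_zero, mul_one]
    congr 1
    exact Real.toNNReal_of_nonneg (sq_nonneg σ)
  have h1 : ∫⁻ ω, ‖X ω‖ₑ ^ p ∂P = ∫⁻ x, ‖x‖ₑ ^ p ∂(P.map X) :=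
    (lintegral_map' (f := fun x : ℝ => ‖x‖ₑ ^ p) (by fun_prop) hX.aemeasurable).symm
  rw [h1, hlaw, lintegral_map (by fun_prop) (by fun_prop),
    ← lintegral_const_mul _ (by fun_prop)]
  refine lintegral_congr fun z => ?_
  rw [enorm_mul, ENNReal.mul_rpow_of_nonneg _ _ hp, Real.enorm_of_nonneg hσ]

lemma lintegral_enorm_rpow_gaussianReal_ne_top {μ : ℝ} {v : ℝ≥0} {p : ℝ} (hp : 0 < p) :
    ∫⁻ z, ‖z‖ₑ ^ p ∂(gaussianReal μ v) ≠ ⊤ := by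
  have h := lintegral_rpow_enorm_lt_top_of_eLpNorm_lt_top (p := (p.toNNReal : ENNReal))
    (by simpa using hp) ENNReal.coe_ne_top
    (memLp_id_gaussianReal (μ := μ) (v := v) p.toNNReal).eLpNorm_lt_top
  simpa [hp.le] using h.ne

namespace IsFractionalBrownianMotion

variable {Ω : Type*} [MeasurableSpace Ω] {P : Measure Ω} {H : ℝ} {B : ℝ≥0 → Ω → ℝ}

lemma integral_sub_eq_zero [IsProbabilityMeasure P] (hB : IsFractionalBrownianMotion H B P)
    (s t : ℝ≥0) : P[B s - B t] = 0 := by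
  have hst : ∫ ω, B s ω ∂P = ∫ ω, B t ω ∂P := by
    obtain ⟨ω, h1, h2⟩ := ((hB.mean_eq s).and (hB.mean_eq t)).exists
    rw [h1, h2]
  simp only [Pi.sub_apply]
  rw [integral_sub (hB.isGaussianProcess.hasGaussianLaw_eval s).integrable
    (hB.isGaussianProcess.hasGaussianLaw_eval t).integrable, hst, sub_self]

lemma variance_sub [IsProbabilityMeasure P] (hB : IsFractionalBrownianMotion H B P) (hH : 0 < H)
    (s t : ℝ≥0) : Var[B s - B t; P] = (dist s t ^ H) ^ 2 := by
  have hs := hB.isGaussianProcess.hasGaussianLaw_eval s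
  have ht := hB.isGaussianProcess.hasGaussianLaw_eval t
  rw [ProbabilityTheory.variance_sub hs.memLp_two ht.memLp_two,
    ← covariance_self hs.aemeasurable, ← covariance_self ht.aemeasurable, hB.covariance_eq,
    hB.covariance_eq, hB.covariance_eq, NNReal.dist_eq, ← Real.rpow_mul_natCast (abs_nonneg _)]
  have h0 : (0 : ℝ) ^ (2 * H) = 0 := Real.zero_rpow (by linarith)
  rw [sub_self, sub_self, abs_zero, h0]
  push_cast
  rw [mul_comm H 2]
  ring

/-- Since the increments are Gaussian, the condition of Kolmogorov holds with every exponent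
`p > 0`. -/
lemma exists_isAEKolmogorovProcess [IsProbabilityMeasure P]
    (hB : IsFractionalBrownianMotion H B P) (hH : 0 < H) {p : ℝ} (hp : 0 < p) :
    ∃ M : ℝ≥0, IsAEKolmogorovProcess B P p (H * p) M := by
  have hmeas := hB.isGaussianProcess.aemeasurable
  refine ⟨(∫⁻ z, ‖z‖ₑ ^ p ∂(gaussianReal 0 1)).toNNReal, fun t => (hmeas t).mk,
    .mk_of_secondCountableTopology (fun t => (hmeas t).measurable_mk) (fun s t => le_of_eq ?_) hp
      (by positivity), fun t => (hmeas t).ae_eq_mk⟩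
  rw [ENNReal.coe_toNNReal (lintegral_enorm_rpow_gaussianReal_ne_top hp)]
  calc _ = ∫⁻ ω, ‖(B s - B t) ω‖ₑ ^ p ∂P := by
        refine lintegral_congr_ae ?_
        filter_upwards [(hmeas s).ae_eq_mk, (hmeas t).ae_eq_mk] with ω h1 h2
        rw [← h1, ← h2, edist_eq_enorm_sub, Pi.sub_apply]
    _ = ENNReal.ofReal (dist s t ^ H) ^ p * ∫⁻ z, ‖z‖ₑ ^ p ∂(gaussianReal 0 1) :=
        hB.isGaussianProcess.hasGaussianLaw_sub.lintegral_enorm_rpow (by positivity) hp.le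
          (hB.integral_sub_eq_zero s t) (hB.variance_sub hH s t)
    _ = _ := by
        rw [← ENNReal.ofReal_rpow_of_nonneg dist_nonneg hH.le, ← ENNReal.rpow_mul, ← edist_dist,
          mul_comm]

/-- Almost surely, the paths are locally Hölder continuous of every order `α < H`. -/
theorem ae_exists_holder [IsProbabilityMeasure P] (hB : IsFractionalBrownianMotion H B P)
    {α : ℝ} (hα : 0 < α) (hαH : α < H) (T : ℝ≥0) :
    ∀ᵐ ω ∂P, ∃ C : ℝ, 0 ≤ C ∧ ∀ s t : ℝ≥0, s ≤ T → t ≤ T → dist s t ≤ 1 →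
      dist (B s ω) (B t ω) ≤ C * dist s t ^ α := by
  have hd : 0 < H - α := sub_pos.2 hαH
  -- the exponent `p` is so large that `1 + α * p < H * p`
  obtain ⟨M, hM⟩ := hB.exists_isAEKolmogorovProcess (hα.trans hαH) (p := 2 / (H - α))
    (by positivity)
  have hpq : 1 + α * (2 / (H - α)) < H * (2 / (H - α)) := by
    have : (H - α) * (2 / (H - α)) = 2 := mul_div_cancel₀ _ hd.ne'
    linarith
  filter_upwards [hM.ae_exists_dyadic_le hpq (⌊T⌋₊ + 1), hB.continuous_paths]
    with ω ⟨C, hC, h⟩ hcont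
  obtain ⟨K, hK, hKb⟩ := hcont.exists_holder_of_dyadic hα hC h
  have hT : T < ((⌊T⌋₊ + 1 : ℕ) : ℝ≥0) := by exact_mod_cast Nat.lt_floor_add_one T
  exact ⟨K, hK, fun s t hs ht => hKb s t (hs.trans_lt hT) (ht.trans_lt hT)⟩

end IsFractionalBrownianMotion

/-! ### The identity for the time average -/

theorem proposition2p5 {Ω : Type*} [MeasurableSpace Ω] (P : Measure Ω) [IsProbabilityMeasure P]
    (H : ℝ) (hH : H ∈ Set.Ioo (1 / 2 : ℝ) 1) (B : ℝ≥0 → Ω → ℝ)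
    (hB : IsFractionalBrownianMotion H B P) (T : ℝ≥0) (hT : 0 < T) :
    (∀ t : ℝ≥0, t ≤ T → ∀ᵐ ω ∂P, ∃ I : ℝ,
      HasRiemannStieltjesIntegral
        (fun s => ((T : ℝ) - (s : ℝ)) / (T : ℝ) * geometricProcess B s ω) (fun s => B s ω) 0 t I ∧
      ((T : ℝ) - (t : ℝ)) / (T : ℝ) * geometricProcess B t ω
          + 1 / (T : ℝ) * ∫ s in (0 : ℝ)..(t : ℝ), geometricProcess B s.toNNReal ω
        = geometricProcess B 0 ω + I) ∧
    (∀ᵐ ω ∂P, ∃ I : ℝ,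
      HasRiemannStieltjesIntegral
        (fun s => ((T : ℝ) - (s : ℝ)) / (T : ℝ) * geometricProcess B s ω) (fun s => B s ω) 0 T I ∧
      1 / (T : ℝ) * ∫ s in (0 : ℝ)..(T : ℝ), geometricProcess B s.toNNReal ω
        = geometricProcess B 0 ω + I) := by
  have main : ∀ t : ℝ≥0, t ≤ T → ∀ᵐ ω ∂P, ∃ I : ℝ,
      HasRiemannStieltjesIntegral
        (fun s => ((T : ℝ) - (s : ℝ)) / (T : ℝ) * geometricProcess B s ω) (fun s => B s ω) 0 t I ∧
      ((T : ℝ) - (t : ℝ)) / (T : ℝ) * geometricProcess B t ω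
          + 1 / (T : ℝ) * ∫ s in (0 : ℝ)..(t : ℝ), geometricProcess B s.toNNReal ω
        = geometricProcess B 0 ω + I := by
    intro t ht
    obtain ⟨α, hα, hαH⟩ := exists_between hH.1
    have hα0 : 0 < α := by linarith
    filter_upwards [hB.ae_exists_holder hα0 hαH T, hB.continuous_paths] with ω ⟨C, hC, h⟩ hcont
    obtain ⟨K, hK, hKb⟩ :=
      exists_abs_timeAverage_sub_le hcont hT hα0 (hαH.trans hH.2).le hC h
    refine ⟨timeAverage T (fun s => B s ω) t - timeAverage T (fun s => B s ω) 0,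
      hasRiemannStieltjesIntegral_of_abs_sub_le (γ := 2 * α) (by linarith) hK
        fun u ξ v h1 h2 h3 => hKb u ξ v h1 h2 (h3.trans ht), ?_⟩
    have hT' : (T : ℝ) ≠ 0 := by exact_mod_cast hT.ne'
    have h0 : timeAverage T (fun s => B s ω) 0 = geometricProcess B 0 ω := by
      simp [timeAverage, geometricProcess, hT']
    rw [h0, add_sub_cancel]
    rfl
  refine ⟨main, ?_⟩
  filter_upwards [main T le_rfl] with ω ⟨I, hI, h⟩
  exact ⟨I, hI, by simpa using h⟩
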